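/- Let $n$ be a positive integer and let $\Pi_n$ be the set of all set partitions of $[n]=\{1,2,\ldots,n\}$. For $\pi\in\Pi_n$: - the *arcs* of $\pi$ are the pairs $(a,b)$ with $a<b$ such that $a$ and $b$ are consecutive elements of the same block of $\pi$ (they lie in a common block that has no element strictly between $a$ and $b$); - the *chords* of $\pi$ are the arcs of $\pi$ together with the pairs $(\min B,\max B)$ for the blocks $B$ of $\pi$ with at least two elements. These are the sides of the polygons obtained when $1,\ldots,n$ are placed in this order on a circle and each block is drawn as a convex polygon; a block of two elements gives a single chord, and a singleton gives none. Two arcs, or two chords, *cross* if they can be named $(a,b)$ and $(c,d)$ with $a<c<b<d$. Let $\mathrm{cr}^{(\ell)}(\pi)$ be the number of unordered pairs of crossing arcs of $\pi$, and $\mathrm{cr}^{(c)}(\pi)$ the number of unordered pairs of crossing chords of $\pi$. Then: 1. For $n\ge 1$, $\displaystyle\max_{\pi\in\Pi_n}\mathrm{cr}^{(\ell)}(\pi)=\left\lfloor\tfrac13\binom{n-1}{2}\right\rfloor$. 2. For $n\ge 5$, $\displaystyle\max_{\pi\in\Pi_n}\mathrm{cr}^{(c)}(\pi)=\left\lfloor\tfrac23\binom{n-1}{2}\right\rfloor$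 if $3$ divides $n$, and $\displaystyle\max_{\pi\in\Pi_n}\mathrm{cr}^{(c)}(\pi)=\left\lfloor\tfrac23\binom{n-2}{2}\right\rfloor$ otherwise. -/

import Mathlib

namespace SetPartitionCrossing

/-- The arcs of a block `B` in the linear representation: the pairs `(a, b)` of consecutive
elements `a < b` of `B`. -/
def blockArcs (B : Finset ℕ) : Finset (ℕ × ℕ) :=
  {e ∈ B ×ˢ B | e.1 < e.2 ∧ ∀ c ∈ B, ¬ (e.1 < c ∧ c < e.2)}

/-- The chords of a block `B` in the circular representation: the sides of the convex polygon
with vertex set `B`, each side being written as `(a, b)` with `a < b`. The sides join consecutive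
elements of `B`, and the smallest to the largest element. A block of size 2 has a single chord,
a block of size 1 has none. -/
def blockChords (B : Finset ℕ) : Finset (ℕ × ℕ) :=
  {e ∈ B ×ˢ B | e.1 < e.2 ∧
    ((∀ c ∈ B, ¬ (e.1 < c ∧ c < e.2)) ∨ (∀ c ∈ B, e.1 ≤ c ∧ c ≤ e.2))}

/-- The arcs of the linear representation of a partition of `[n] = {1, …, n}`. -/
def arcs {n : ℕ} (π : Finpartition (Finset.Icc 1 n)) : Finset (ℕ × ℕ) :=
  π.parts.biUnion blockArcs

/-- The chords of the circular representation of a partition of `[n] = {1, …, n}`. -/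
def chords {n : ℕ} (π : Finpartition (Finset.Icc 1 n)) : Finset (ℕ × ℕ) :=
  π.parts.biUnion blockChords

/-- The number of (unordered) pairs of crossing edges in a set `E` of edges `(a, b)`, `a < b`,
where the edges are drawn as arcs over a line or as chords of a circle. Two edges cross when their
endpoints strictly interleave; each crossing pair is counted once, with the edge that has the
smaller left endpoint written first. -/
def numCrossings (E : Finset (ℕ × ℕ)) : ℕ :=
  {p ∈ E ×ˢ E | p.1.1 < p.2.1 ∧ p.2.1 < p.1.2 ∧ p.1.2 < p.2.2}.card

/-- The number of pairs of crossing arcs in the linear representation. -/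
def crLin {n : ℕ} (π : Finpartition (Finset.Icc 1 n)) : ℕ := numCrossings (arcs π)

/-- The number of pairs of crossing chords in the circular representation. -/
def crCirc {n : ℕ} (π : Finpartition (Finset.Icc 1 n)) : ℕ := numCrossings (chords π)

end SetPartitionCrossing

namespace SetPartitionCrossing

open Finset

/-! Upper bounds. Edges of one block never cross, so the crossings split into contributions of pairs
of blocks, each controlled by the smaller block. For arcs, a pair whose smaller block has size `x`
has at most `2x - 2` crossings, and at most `2x - 3` if the sizes agree
(`card_crossings_blockArcs_le`, `card_crossings_blockArcs_le_of_card_eq`). For chords, each side of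
one polygon meets at most two sides of the other, so there are at most twice as many crossings as
the smaller block has sides (`card_crossings_blockChords_le`); blocks of size 1 and 2 have 0 and at
most 1 sides.

What remains is an optimisation over block sizes. Blocks are added in order of decreasing size, so
that the new block is always the smaller one in its pairs, and the bound is shown to grow by enough
at each step (`linear_weight_bound`, `chord_weight_bound`). Blocks of size 3 are the critical case;
the other sizes lose something or need an integrality argument.

Lower bounds. The classes modulo `k`, with `k` about `n / 3`, give triangles any two of which cross
as often as possible. For arcs `k` is `n / 3` rounded up. For chords with `n = 3m` or `n = 3m + 1`
take `k = m`, a leftover point being a singleton; with `n = 3m + 2` take `k = m + 1`, which gives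
`m` triangles and one pair. -/

/-- The pairs of crossing edges `(e, f)` with `e ∈ E`, `f ∈ F`, where `e` has the smaller left
endpoint. -/
def crossingPairs (E F : Finset (ℕ × ℕ)) : Finset ((ℕ × ℕ) × (ℕ × ℕ)) :=
  {p ∈ E ×ˢ F | p.1.1 < p.2.1 ∧ p.2.1 < p.1.2 ∧ p.1.2 < p.2.2}

theorem mem_crossingPairs {E F : Finset (ℕ × ℕ)} {e f : ℕ × ℕ} :
    (e, f) ∈ crossingPairs E F ↔ e ∈ E ∧ f ∈ F ∧ e.1 < f.1 ∧ f.1 < e.2 ∧ e.2 < f.2 := by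
  simp [crossingPairs, and_assoc]

theorem numCrossings_biUnion_le {ι : Type*} (s : Finset ι) (E : ι → Finset (ℕ × ℕ)) :
    numCrossings (s.biUnion E) ≤ ∑ i ∈ s, ∑ j ∈ s, #(crossingPairs (E i) (E j)) := by
  rw [← sum_product']
  refine (card_le_card ?_).trans (card_biUnion_le (s := s ×ˢ s)
    (t := fun x => crossingPairs (E x.1) (E x.2)))
  rintro ⟨e, f⟩ h
  obtain ⟨he, hf, h⟩ := mem_crossingPairs.1 h
  simp only [mem_biUnion, mem_product, Prod.exists, mem_crossingPairs] at he hf ⊢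
  obtain ⟨i, hi, he⟩ := he
  obtain ⟨j, hj, hf⟩ := hf
  exact ⟨i, j, ⟨hi, hj⟩, he, hf, h⟩

/-! ### Arcs and chords of a single block -/

theorem mem_blockArcs {B : Finset ℕ} {e : ℕ × ℕ} :
    e ∈ blockArcs B ↔ e.1 ∈ B ∧ e.2 ∈ B ∧ e.1 < e.2 ∧ ∀ c ∈ B, ¬ (e.1 < c ∧ c < e.2) := by
  simp [blockArcs, and_assoc]

/-- The side joining the smallest to the largest element of a block. -/
def closingChords (B : Finset ℕ) : Finset (ℕ × ℕ) :=
  {e ∈ B ×ˢ B | e.1 < e.2 ∧ ∀ c ∈ B, e.1 ≤ c ∧ c ≤ e.2}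

theorem mem_closingChords {B : Finset ℕ} {e : ℕ × ℕ} :
    e ∈ closingChords B ↔ e.1 ∈ B ∧ e.2 ∈ B ∧ e.1 < e.2 ∧ ∀ c ∈ B, e.1 ≤ c ∧ c ≤ e.2 := by
  simp [closingChords, and_assoc]

theorem blockChords_eq (B : Finset ℕ) : blockChords B = blockArcs B ∪ closingChords B := by
  ext e
  simp only [blockChords, mem_union, mem_blockArcs, mem_closingChords, mem_filter, mem_product]
  tauto

theorem arc_eq_of_cover {B : Finset ℕ} {e f : ℕ × ℕ} {x : ℕ} (he : e ∈ blockArcs B)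
    (hf : f ∈ blockArcs B) (h1 : e.1 < x) (h2 : x < e.2) (h3 : f.1 < x) (h4 : x < f.2) :
    e = f := by
  rw [mem_blockArcs] at he hf
  obtain ⟨e1, e2, -, he⟩ := he
  obtain ⟨f1, f2, -, hf⟩ := hf
  have := he _ f1
  have := he _ f2
  have := hf _ e1
  have := hf _ e2
  ext <;> omega

theorem arc_eq_of_snd_eq {B : Finset ℕ} {e f : ℕ × ℕ} (he : e ∈ blockArcs B)
    (hf : f ∈ blockArcs B) (h : e.2 = f.2) : e = f := by
  rw [mem_blockArcs] at he hf
  obtain ⟨e1, e2, e3, he⟩ := he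
  obtain ⟨f1, f2, f3, hf⟩ := hf
  have := he _ f1
  have := hf _ e1
  ext <;> omega

theorem arc_eq_of_fst_eq {B : Finset ℕ} {e f : ℕ × ℕ} (he : e ∈ blockArcs B)
    (hf : f ∈ blockArcs B) (h : e.1 = f.1) : e = f := by
  rw [mem_blockArcs] at he hf
  obtain ⟨e1, e2, e3, he⟩ := he
  obtain ⟨f1, f2, f3, hf⟩ := hf
  have := he _ f2
  have := hf _ e2
  ext <;> omega

theorem closingChords_subsingleton {B : Finset ℕ} {e f : ℕ × ℕ} (he : e ∈ closingChords B)
    (hf : f ∈ closingChords B) : e = f := by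
  rw [mem_closingChords] at he hf
  obtain ⟨e1, e2, -, he⟩ := he
  obtain ⟨f1, f2, -, hf⟩ := hf
  have := he _ f1
  have := he _ f2
  have := hf _ e1
  have := hf _ e2
  ext <;> omega

theorem card_blockArcs_le {B : Finset ℕ} (hB : B.Nonempty) : #(blockArcs B) ≤ #B - 1 := by
  rw [← card_erase_of_mem (B.min'_mem hB)]
  refine card_le_card_of_injOn Prod.snd (fun e he => ?_)
    (fun e he f hf h => arc_eq_of_snd_eq he hf h)
  obtain ⟨e1, e2, h, -⟩ := mem_blockArcs.1 he
  have := B.min'_le _ e1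
  simp only [coe_erase, Set.mem_sdiff, mem_coe, Set.mem_singleton_iff]
  exact ⟨e2, by omega⟩

theorem blockChords_eq_empty {B : Finset ℕ} (h : #B = 1) : blockChords B = ∅ := by
  obtain ⟨x, rfl⟩ := card_eq_one.1 h
  refine eq_empty_of_forall_notMem fun e he => ?_
  simp only [blockChords, mem_filter, mem_product, mem_singleton] at he
  omega

theorem card_blockChords_le {B : Finset ℕ} (hB : B.Nonempty) : #(blockChords B) ≤ #B := by
  rw [blockChords_eq]
  have h1 := card_blockArcs_le hB
  have h2 : #(closingChords B) ≤ 1 :=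
    card_le_one.2 fun e he f hf => closingChords_subsingleton he hf
  have := hB.card_pos
  exact (card_union_le _ _).trans (by omega)

theorem card_blockChords_le_one {B : Finset ℕ} (h : #B = 2) : #(blockChords B) ≤ 1 := by
  obtain ⟨x, y, -, rfl⟩ := card_eq_two.1 h
  refine card_le_one.2 fun e he f hf => ?_
  simp only [blockChords, mem_filter, mem_product, mem_insert, mem_singleton] at he hf
  ext <;> omega

theorem crossingPairs_blockChords_self (B : Finset ℕ) :
    crossingPairs (blockChords B) (blockChords B) = ∅ := by
  refine eq_empty_of_forall_notMem ?_
  rintro ⟨e, f⟩ h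
  obtain ⟨he, hf, h1, h2, h3⟩ := mem_crossingPairs.1 h
  simp only [blockChords, mem_filter, mem_product] at he hf
  obtain ⟨⟨e1, e2⟩, -, he⟩ := he
  obtain ⟨⟨f1, f2⟩, -, hf⟩ := hf
  rcases he with he | he
  · exact he _ f1 ⟨h1, h2⟩
  · have := he _ f2
    omega

theorem crossingPairs_blockArcs_self (B : Finset ℕ) :
    crossingPairs (blockArcs B) (blockArcs B) = ∅ := by
  rw [← subset_empty, ← crossingPairs_blockChords_self B, blockChords_eq]
  exact filter_subset_filter _ (product_subset_product subset_union_left subset_union_left)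

/-! ### Crossings of the arcs of two blocks -/

/-- The right endpoint of the arc of `A` determines the crossing: it determines that arc, and at
most one arc of `B` passes over it. The minimum of `A` is not a right endpoint. -/
theorem card_crossingPairs_blockArcs_left {A : Finset ℕ} (hA : A.Nonempty) (B : Finset ℕ) :
    #(crossingPairs (blockArcs A) (blockArcs B)) ≤ #A - 1 := by
  rw [← card_erase_of_mem (A.min'_mem hA)]
  refine card_le_card_of_injOn (fun p => p.1.2) ?_ ?_
  · rintro ⟨e, f⟩ h
    obtain ⟨he, -, h⟩ := mem_crossingPairs.1 h
    obtain ⟨e1, e2, h, -⟩ := mem_blockArcs.1 he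
    have := A.min'_le _ e1
    simp only [coe_erase, Set.mem_sdiff, mem_coe, Set.mem_singleton_iff]
    exact ⟨e2, by omega⟩
  · rintro ⟨e, f⟩ h ⟨e', f'⟩ h' heq
    obtain ⟨he, hf, h⟩ := mem_crossingPairs.1 h
    obtain ⟨he', hf', h'⟩ := mem_crossingPairs.1 h'
    dsimp only at heq
    rw [arc_eq_of_snd_eq he he' heq,
      arc_eq_of_cover hf hf' h.2.1 h.2.2 (heq ▸ h'.2.1) (heq ▸ h'.2.2)]

theorem injOn_crossingPairs_right (A B : Finset ℕ) :
    Set.InjOn (fun p : (ℕ × ℕ) × (ℕ × ℕ) => p.2.1)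
      (crossingPairs (blockArcs B) (blockArcs A) : Set ((ℕ × ℕ) × (ℕ × ℕ))) := by
  rintro ⟨e, f⟩ h ⟨e', f'⟩ h' heq
  obtain ⟨he, hf, h⟩ := mem_crossingPairs.1 h
  obtain ⟨he', hf', h'⟩ := mem_crossingPairs.1 h'
  dsimp only at heq
  rw [arc_eq_of_fst_eq hf hf' heq,
    arc_eq_of_cover he he' h.1 h.2.1 (heq ▸ h'.1) (heq ▸ h'.2.1)]

theorem card_crossingPairs_blockArcs_right {A : Finset ℕ} (hA : A.Nonempty) (B : Finset ℕ) :
    #(crossingPairs (blockArcs B) (blockArcs A)) ≤ #A - 1 := by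
  rw [← card_erase_of_mem (A.max'_mem hA)]
  refine card_le_card_of_injOn (fun p => p.2.1) ?_ (injOn_crossingPairs_right A B)
  rintro ⟨e, f⟩ h
  obtain ⟨-, hf, h⟩ := mem_crossingPairs.1 h
  obtain ⟨f1, f2, h, -⟩ := mem_blockArcs.1 hf
  have := A.le_max' _ f2
  simp only [coe_erase, Set.mem_sdiff, mem_coe, Set.mem_singleton_iff]
  exact ⟨f1, by omega⟩

/-- A crossing is determined by the left endpoint of the arc of `A`. Besides the maximum of `A`, the
point `m` is excluded too, since no arc of `B` starts to its left. -/
theorem card_crossingPairs_blockArcs_right_of_min_lt {A B : Finset ℕ} {m : ℕ} (hm : m ∈ A)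
    (hB : ∀ b ∈ B, m < b) : #(crossingPairs (blockArcs B) (blockArcs A)) ≤ #A - 2 := by
  have hA : A.Nonempty := ⟨m, hm⟩
  by_cases hmax : A.max' hA = m
  · have : crossingPairs (blockArcs B) (blockArcs A) = ∅ := by
      refine eq_empty_of_forall_notMem ?_
      rintro ⟨e, f⟩ h
      obtain ⟨he, hf, h⟩ := mem_crossingPairs.1 h
      have := hB _ (mem_blockArcs.1 he).1
      have := A.le_max' _ (mem_blockArcs.1 hf).1
      omega
    simp [this]
  have hcard : #((A.erase (A.max' hA)).erase m) = #A - 2 := by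
    rw [card_erase_of_mem (mem_erase.2 ⟨Ne.symm hmax, hm⟩), card_erase_of_mem (A.max'_mem hA)]
    omega
  rw [← hcard]
  refine card_le_card_of_injOn (fun p => p.2.1) ?_ (injOn_crossingPairs_right A B)
  rintro ⟨e, f⟩ h
  obtain ⟨he, hf, h⟩ := mem_crossingPairs.1 h
  obtain ⟨f1, f2, -, -⟩ := mem_blockArcs.1 hf
  have := A.le_max' _ f2
  have := hB _ (mem_blockArcs.1 he).1
  simp only [mem_coe, mem_erase]
  exact ⟨by omega, by omega, f1⟩

theorem card_crossings_blockArcs_le {A : Finset ℕ} (hA : A.Nonempty) (B : Finset ℕ) :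
    #(crossingPairs (blockArcs A) (blockArcs B)) + #(crossingPairs (blockArcs B) (blockArcs A))
      ≤ 2 * #A - 2 := by
  have := card_crossingPairs_blockArcs_left hA B
  have := card_crossingPairs_blockArcs_right hA B
  omega

/-- Disjoint blocks have different minima. The block with the smaller minimum loses one more
possible crossing, and equal sizes make it irrelevant which block that is. -/
theorem card_crossings_blockArcs_le_of_card_eq {A B : Finset ℕ} (hA : A.Nonempty)
    (hB : B.Nonempty) (hAB : Disjoint A B) (h : #A = #B) :
    #(crossingPairs (blockArcs A) (blockArcs B)) + #(crossingPairs (blockArcs B) (blockArcs A))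
      ≤ 2 * #A - 3 := by
  rcases lt_trichotomy (A.min' hA) (B.min' hB) with hlt | heq | hlt
  · have := card_crossingPairs_blockArcs_left hA B
    have := card_crossingPairs_blockArcs_right_of_min_lt (A.min'_mem hA)
      fun b hb => hlt.trans_le (B.min'_le b hb)
    omega
  · exact absurd (heq ▸ B.min'_mem hB) (disjoint_left.1 hAB (A.min'_mem hA))
  · have := card_crossingPairs_blockArcs_left hB A
    have := card_crossingPairs_blockArcs_right_of_min_lt (B.min'_mem hB)
      fun b hb => hlt.trans_le (A.min'_le b hb)
    omega

/-! ### Crossings of the chords of two blocks -/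

theorem card_crossingPairs_eq_sum_left (E F : Finset (ℕ × ℕ)) :
    #(crossingPairs E F) = ∑ e ∈ E, #{f ∈ F | e.1 < f.1 ∧ f.1 < e.2 ∧ e.2 < f.2} := by
  simp only [crossingPairs, card_filter, sum_product]

theorem card_crossingPairs_eq_sum_right (E F : Finset (ℕ × ℕ)) :
    #(crossingPairs F E) = ∑ e ∈ E, #{f ∈ F | f.1 < e.1 ∧ e.1 < f.2 ∧ f.2 < e.2} := by
  simp only [crossingPairs, card_filter, sum_product_right]

/-- A chord crosses at most two sides of a convex polygon. -/
theorem card_sides_crossed_le_two (B : Finset ℕ) (e : ℕ × ℕ) :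
    #{f ∈ blockChords B | e.1 < f.1 ∧ f.1 < e.2 ∧ e.2 < f.2} +
      #{f ∈ blockChords B | f.1 < e.1 ∧ e.1 < f.2 ∧ f.2 < e.2} ≤ 2 := by
  have ha : #{f ∈ blockArcs B | e.1 < f.1 ∧ f.1 < e.2 ∧ e.2 < f.2} ≤ 1 := by
    refine card_le_one.2 fun f hf g hg => ?_
    rw [mem_filter] at hf hg
    exact arc_eq_of_cover hf.1 hg.1 hf.2.2.1 hf.2.2.2 hg.2.2.1 hg.2.2.2
  have ha' : #{f ∈ blockArcs B | f.1 < e.1 ∧ e.1 < f.2 ∧ f.2 < e.2} ≤ 1 := by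
    refine card_le_one.2 fun f hf g hg => ?_
    rw [mem_filter] at hf hg
    exact arc_eq_of_cover hf.1 hg.1 hf.2.1 hf.2.2.1 hg.2.1 hg.2.2.1
  have hc : #{f ∈ closingChords B | e.1 < f.1 ∧ f.1 < e.2 ∧ e.2 < f.2} ≤ 1 := by
    refine card_le_one.2 fun f hf g hg => ?_
    rw [mem_filter] at hf hg
    exact closingChords_subsingleton hf.1 hg.1
  have hc' : #{f ∈ closingChords B | f.1 < e.1 ∧ e.1 < f.2 ∧ f.2 < e.2} ≤ 1 := by
    refine card_le_one.2 fun f hf g hg => ?_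
    rw [mem_filter] at hf hg
    exact closingChords_subsingleton hf.1 hg.1
  have hu : #{f ∈ blockChords B | e.1 < f.1 ∧ f.1 < e.2 ∧ e.2 < f.2} ≤
      #{f ∈ blockArcs B | e.1 < f.1 ∧ f.1 < e.2 ∧ e.2 < f.2} +
      #{f ∈ closingChords B | e.1 < f.1 ∧ f.1 < e.2 ∧ e.2 < f.2} := by
    rw [blockChords_eq, filter_union]
    exact card_union_le _ _
  have hu' : #{f ∈ blockChords B | f.1 < e.1 ∧ e.1 < f.2 ∧ f.2 < e.2} ≤
      #{f ∈ blockArcs B | f.1 < e.1 ∧ e.1 < f.2 ∧ f.2 < e.2} +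
      #{f ∈ closingChords B | f.1 < e.1 ∧ e.1 < f.2 ∧ f.2 < e.2} := by
    rw [blockChords_eq, filter_union]
    exact card_union_le _ _
  -- At most one arc of `B` passes over each end of `e`. If `B` has points on both outer sides of
  -- `e`, its closing chord encloses `e` and does not cross it; otherwise one of the two counts
  -- vanishes and the other is at most one arc plus the closing chord.
  by_cases hlow : ∃ b ∈ B, b < e.1
  · by_cases hhigh : ∃ b ∈ B, e.2 < b
    · obtain ⟨b, hb, hbe⟩ := hlow
      obtain ⟨d, hd, hde⟩ := hhigh
      have h1 : #{f ∈ closingChords B | e.1 < f.1 ∧ f.1 < e.2 ∧ e.2 < f.2} = 0 := by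
        refine card_eq_zero.2 (filter_eq_empty_iff.2 fun f hf h => ?_)
        have := (mem_closingChords.1 hf).2.2.2 b hb
        omega
      have h2 : #{f ∈ closingChords B | f.1 < e.1 ∧ e.1 < f.2 ∧ f.2 < e.2} = 0 := by
        refine card_eq_zero.2 (filter_eq_empty_iff.2 fun f hf h => ?_)
        have := (mem_closingChords.1 hf).2.2.2 d hd
        omega
      omega
    · have : #{f ∈ blockChords B | e.1 < f.1 ∧ f.1 < e.2 ∧ e.2 < f.2} = 0 := by
        refine card_eq_zero.2 (filter_eq_empty_iff.2 fun f hf h => hhigh ⟨f.2, ?_, h.2.2⟩)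
        exact (mem_product.1 (mem_filter.1 hf).1).2
      omega
  · have : #{f ∈ blockChords B | f.1 < e.1 ∧ e.1 < f.2 ∧ f.2 < e.2} = 0 := by
      refine card_eq_zero.2 (filter_eq_empty_iff.2 fun f hf h => hlow ⟨f.1, ?_, h.1⟩)
      exact (mem_product.1 (mem_filter.1 hf).1).1
    omega

theorem card_crossings_blockChords_le (A B : Finset ℕ) :
    #(crossingPairs (blockChords A) (blockChords B)) +
      #(crossingPairs (blockChords B) (blockChords A)) ≤ 2 * #(blockChords A) := by
  rw [card_crossingPairs_eq_sum_left, card_crossingPairs_eq_sum_right (blockChords A),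
    ← sum_add_distrib, mul_comm, ← smul_eq_mul]
  exact sum_le_card_nsmul _ _ _ fun e _ => card_sides_crossed_le_two B e

theorem card_crossings_le_one {E F : Finset (ℕ × ℕ)} (hE : #E ≤ 1) (hF : #F ≤ 1) :
    #(crossingPairs E F) + #(crossingPairs F E) ≤ 1 := by
  have h : ∀ {E F : Finset (ℕ × ℕ)}, #E ≤ 1 → #F ≤ 1 → #(crossingPairs E F) ≤ 1 := by
    intro E F hE hF
    refine (card_filter_le _ _).trans ?_
    rw [card_product]
    exact Nat.mul_le_mul hE hF
  by_cases h0 : crossingPairs F E = ∅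
  · simpa [h0] using h hE hF
  · obtain ⟨⟨f, e⟩, hfe⟩ := nonempty_iff_ne_empty.2 h0
    obtain ⟨hf, he, hfe⟩ := mem_crossingPairs.1 hfe
    have : crossingPairs E F = ∅ := by
      refine eq_empty_of_forall_notMem ?_
      rintro ⟨e', f'⟩ h
      obtain ⟨he', hf', h⟩ := mem_crossingPairs.1 h
      rw [card_le_one.1 hE e' he' e he, card_le_one.1 hF f' hf' f hf] at h
      omega
    simpa [this] using h hF hE

/-! ### Optimisation over the block sizes -/

theorem sum_sum_insert {ι : Type*} [DecidableEq ι] {a : ι} {s : Finset ι} (ha : a ∉ s)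
    (w : ι → ι → ℕ) :
    ∑ i ∈ insert a s, ∑ j ∈ insert a s, w i j =
      (∑ i ∈ s, ∑ j ∈ s, w i j) + ∑ j ∈ s, (w a j + w j a) + w a a := by
  simp only [sum_insert ha, sum_add_distrib]
  ring

/-- A sum of pair weights over the elements of a finset, split according to a predicate, together
with a lower bound for the total size. -/
theorem sum_le_and_le_sum_of_split {ι : Type*} (s : Finset ι) (p : ι → Prop) [DecidablePred p]
    (f g : ι → ℕ) {c d x y : ℕ} (hc : ∀ i ∈ s, p i → g i ≤ c) (hd : ∀ i ∈ s, ¬ p i → g i ≤ d)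
    (hx : ∀ i ∈ s, p i → x ≤ f i) (hy : ∀ i ∈ s, ¬ p i → y ≤ f i) :
    ∃ t u : ℕ, ∑ i ∈ s, g i ≤ t * c + u * d ∧ t * x + u * y ≤ ∑ i ∈ s, f i := by
  refine ⟨#{i ∈ s | p i}, #{i ∈ s | ¬ p i}, ?_, ?_⟩
  · rw [← sum_filter_add_sum_filter_not s p g]
    refine Nat.add_le_add (sum_le_card_nsmul _ _ _ fun i hi => ?_)
      (sum_le_card_nsmul _ _ _ fun i hi => ?_)
    · exact hc i (mem_filter.1 hi).1 (mem_filter.1 hi).2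
    · exact hd i (mem_filter.1 hi).1 (mem_filter.1 hi).2
  · rw [← sum_filter_add_sum_filter_not s p f]
    refine Nat.add_le_add (card_nsmul_le_sum _ _ _ fun i hi => ?_)
      (card_nsmul_le_sum _ _ _ fun i hi => ?_)
    · exact hx i (mem_filter.1 hi).1 (mem_filter.1 hi).2
    · exact hy i (mem_filter.1 hi).1 (mem_filter.1 hi).2

theorem linear_step_two {T N t u : ℤ} (hT : 6 * T ≤ (N - 1) * (N - 2)) (ht : 0 ≤ t)
    (hN : t * 2 + u * 3 ≤ N) : 6 * (T + (t * 1 + u * 2)) ≤ (N + 2 - 1) * (N + 2 - 2) := by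
  -- The right side grows by `4 * N - 2`, which is 2 short exactly when `t = 0` and `N = 3 * u`.
  -- There `6 * T ≤ 9 * u * (u - 1) + 2`; since `u * (u - 1)` is even, divisibility by 6 removes the
  -- 2.
  by_cases h : t = 0 ∧ N = u * 3
  · obtain ⟨rfl, rfl⟩ := h
    obtain ⟨v, hv⟩ := Int.even_mul_pred_self u
    have h1 : 6 * T ≤ 9 * (v + v) + 2 := by rw [← hv]; linarith
    have h2 : 6 * T ≤ 9 * (v + v) := by omega
    rw [← hv] at h2
    linarith
  · have : 4 * N - 2 ≥ 6 * t + 12 * u := by omega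
    linarith

/-- The right side grows by `2 * x * N + x * (x - 3)`. Inserting the lower bound for `N` leaves the
slack `2t(x - 3)² + 2u(x - 2)(x - 3) + x(x - 3)`, which vanishes at `x = 3`. -/
theorem linear_step_ge_three {T N t u x : ℤ} (hx : 3 ≤ x) (ht : 0 ≤ t) (hu : 0 ≤ u)
    (hT : 6 * T ≤ (N - 1) * (N - 2)) (hN : t * x + u * (x + 1) ≤ N) :
    6 * (T + (t * (2 * x - 3) + u * (2 * x - 2))) ≤ (N + x - 1) * (N + x - 2) := by
  have h1 : 2 * x * (t * x + u * (x + 1)) ≤ 2 * x * N :=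
    mul_le_mul_of_nonneg_left hN (by linarith)
  have h2 : 0 ≤ t * (x - 3) ^ 2 := by positivity
  have h3 : 0 ≤ u * ((x - 2) * (x - 3)) :=
    mul_nonneg hu (mul_nonneg (by linarith) (by linarith))
  have h4 : 0 ≤ x * (x - 3) := mul_nonneg (by linarith) (by linarith)
  linarith

/-- Induction adding an element `a` of minimal size `x`: of the others, `t` have size `x` and `u`
have size at least `x + 1`, and the weights between them and `a` are bounded in terms of `x` alone.
-/
theorem linear_weight_bound {ι : Type*} [DecidableEq ι] (s : Finset ι) (f : ι → ℕ)
    (w : ι → ι → ℕ) (hf : ∀ i ∈ s, 1 ≤ f i) (hdiag : ∀ i ∈ s, w i i = 0)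
    (hw : ∀ i ∈ s, ∀ j ∈ s, w i j + w j i ≤ 2 * f i - 2)
    (hw' : ∀ i ∈ s, ∀ j ∈ s, i ≠ j → f i = f j → w i j + w j i ≤ 2 * f i - 3) :
    6 * ((∑ i ∈ s, ∑ j ∈ s, w i j : ℕ) : ℤ) ≤
      (((∑ i ∈ s, f i : ℕ) : ℤ) - 1) * (((∑ i ∈ s, f i : ℕ) : ℤ) - 2) := by
  induction s using Finset.induction_on_min_value f with
  | empty => simp
  | insert a s ha hmin ih =>
    specialize ih (fun i hi => hf i (mem_insert_of_mem hi))
      (fun i hi => hdiag i (mem_insert_of_mem hi))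
      (fun i hi j hj => hw i (mem_insert_of_mem hi) j (mem_insert_of_mem hj))
      (fun i hi j hj => hw' i (mem_insert_of_mem hi) j (mem_insert_of_mem hj))
    have has := mem_insert_self a s
    rw [sum_sum_insert ha, hdiag a has, sum_insert ha, add_zero]
    obtain ⟨t, u, h1, h2⟩ := sum_le_and_le_sum_of_split s (fun j => f a = f j) f
      (fun j => w a j + w j a) (c := 2 * f a - 3) (d := 2 * f a - 2) (x := f a) (y := f a + 1)
      (fun j hj h => hw' a has j (mem_insert_of_mem hj) (fun h => ha (h ▸ hj)) h)
      (fun j hj _ => hw a has j (mem_insert_of_mem hj))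
      (fun j hj h => h.le) (fun j hj h => lt_of_le_of_ne (hmin j hj) h)
    have hfa := hf a has
    generalize f a = x at *
    generalize ∑ i ∈ s, ∑ j ∈ s, w i j = T at *
    generalize ∑ j ∈ s, (w a j + w j a) = D at *
    generalize ∑ i ∈ s, f i = N at *
    obtain rfl | rfl | hx : x = 1 ∨ x = 2 ∨ 3 ≤ x := by omega
    -- Truncated subtraction makes both `2 * 1 - 3` and `2 * 1 - 2` zero: a singleton crosses
    -- nothing.
    · have hD : D = 0 := by simpa using h1
      subst hD
      push_cast
      rcases Nat.eq_zero_or_pos N with rfl | hN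
      · simp at ih ⊢
        omega
      · have : (1 : ℤ) ≤ N := by exact_mod_cast hN
        linarith
    · have h3 : (D : ℤ) ≤ t * 1 + u * 2 := by exact_mod_cast h1
      have h4 : (t : ℤ) * 2 + u * 3 ≤ N := by exact_mod_cast h2
      have := linear_step_two ih (by positivity) h4
      push_cast
      rw [add_comm (2 : ℤ) N]
      linarith
    · have h3 : (D : ℤ) ≤ t * (2 * x - 3) + u * (2 * x - 2) := by
        have e1 : ((2 * x - 3 : ℕ) : ℤ) = 2 * x - 3 := by omega
        have e2 : ((2 * x - 2 : ℕ) : ℤ) = 2 * x - 2 := by omega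
        rw [← e1, ← e2]
        exact_mod_cast h1
      have h4 : (t : ℤ) * x + u * (x + 1) ≤ N := by exact_mod_cast h2
      have := linear_step_ge_three (by exact_mod_cast hx) (by positivity) (by positivity) ih h4
      push_cast
      rw [add_comm (x : ℤ) N]
      linarith

/-! ### Optimisation over the block sizes for chords -/

/-- The bound for the number of chord crossings in terms of the number of points; the case of
four points is exceptional. -/
def ChordBound (T N : ℤ) : Prop :=
  (N % 3 = 0 → 3 * T ≤ N * (N - 3)) ∧ (N % 3 = 1 → N ≠ 4 → 3 * T ≤ (N - 1) * (N - 4)) ∧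
    (N = 4 → T ≤ 1) ∧ (N % 3 = 2 → 3 * T ≤ (N - 2) * (N - 3))

theorem chordBound_of_exists {T N : ℤ}
    (h : ∃ m : ℤ, (N = 3 * m ∧ T ≤ 3 * m * (m - 1)) ∨
      (N = 3 * m + 1 ∧ N ≠ 4 ∧ T ≤ 3 * m * (m - 1)) ∨ (N = 4 ∧ T ≤ 1) ∨
      (N = 3 * m + 2 ∧ T ≤ m * (3 * m - 1))) : ChordBound T N := by
  obtain ⟨m, ⟨rfl, h⟩ | ⟨rfl, h', h⟩ | ⟨rfl, h⟩ | ⟨rfl, h⟩⟩ := h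
  · exact ⟨fun _ => by linarith, fun _ => by omega, fun _ => by omega, fun _ => by omega⟩
  · exact ⟨fun _ => by omega, fun _ _ => by linarith, fun _ => by omega, fun _ => by omega⟩
  · exact ⟨fun _ => by omega, fun _ => by omega, fun _ => by omega, fun _ => by omega⟩
  · exact ⟨fun _ => by omega, fun _ => by omega, fun _ => by omega, fun _ => by linarith⟩

theorem ChordBound.exists {T N : ℤ} (h : ChordBound T N) :
    ∃ m : ℤ, (N = 3 * m ∧ T ≤ 3 * m * (m - 1)) ∨
      (N = 3 * m + 1 ∧ N ≠ 4 ∧ T ≤ 3 * m * (m - 1)) ∨ (N = 4 ∧ T ≤ 1) ∨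
      (N = 3 * m + 2 ∧ T ≤ m * (3 * m - 1)) := by
  obtain ⟨h0, h1, h4, h2⟩ := h
  refine ⟨N / 3, ?_⟩
  by_cases e4 : N = 4
  · exact .inr (.inr (.inl ⟨e4, h4 e4⟩))
  obtain hr | hr | hr : N % 3 = 0 ∨ N % 3 = 1 ∨ N % 3 = 2 := by omega
  · obtain ⟨m, rfl⟩ : ∃ m, N = 3 * m := ⟨N / 3, by omega⟩
    have e : 3 * m / 3 = m := by omega
    have := h0 hr
    rw [e]
    exact .inl ⟨rfl, by linarith⟩
  · obtain ⟨m, rfl⟩ : ∃ m, N = 3 * m + 1 := ⟨N / 3, by omega⟩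
    have e : (3 * m + 1) / 3 = m := by omega
    have := h1 hr e4
    rw [e]
    exact .inr (.inl ⟨rfl, e4, by linarith⟩)
  · obtain ⟨m, rfl⟩ : ∃ m, N = 3 * m + 2 := ⟨N / 3, by omega⟩
    have e : (3 * m + 2) / 3 = m := by omega
    have := h2 hr
    rw [e]
    exact .inr (.inr (.inr ⟨rfl, by linarith⟩))

theorem chordBound_add_one {T N : ℤ} (h : ChordBound T N) (hN : 0 ≤ N) : ChordBound T (N + 1) := by
  obtain ⟨m, ⟨rfl, hT⟩ | ⟨rfl, h', hT⟩ | ⟨rfl, hT⟩ | ⟨rfl, hT⟩⟩ := h.exists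
  · by_cases hm : m = 1
    · subst hm
      exact chordBound_of_exists ⟨1, .inr (.inr (.inl ⟨by norm_num, by linarith⟩))⟩
    · exact chordBound_of_exists ⟨m, .inr (.inl ⟨rfl, by omega, hT⟩)⟩
  · exact chordBound_of_exists ⟨m, .inr (.inr (.inr ⟨by ring, by linarith⟩))⟩
  · exact chordBound_of_exists ⟨1, .inr (.inr (.inr ⟨by norm_num, by linarith⟩))⟩
  · refine chordBound_of_exists ⟨m + 1, .inl ⟨by ring, ?_⟩⟩
    have : 0 ≤ m := by omega
    linarith

theorem chordBound_add_two {T D N t u : ℤ} (h : ChordBound T N) (hN : 0 ≤ N) (ht : 0 ≤ t)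
    (hu : 0 ≤ u) (hD : D ≤ t * 1 + u * 2) (hlt : t * 2 + u * 3 ≤ N) :
    ChordBound (T + D) (N + 2) := by
  obtain ⟨m, ⟨rfl, hT⟩ | ⟨rfl, h', hT⟩ | ⟨rfl, hT⟩ | ⟨rfl, hT⟩⟩ := h.exists
  · exact chordBound_of_exists ⟨m, .inr (.inr (.inr ⟨by ring, by linarith⟩))⟩
  · refine chordBound_of_exists ⟨m + 1, .inl ⟨by ring, ?_⟩⟩
    have : D ≤ 2 * m := by omega
    have : 0 ≤ m := by omega
    linarith
  · exact chordBound_of_exists ⟨2, .inl ⟨by norm_num, by omega⟩⟩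
  · by_cases hm : m = 0
    · subst hm
      exact chordBound_of_exists ⟨1, .inr (.inr (.inl ⟨by norm_num, by omega⟩))⟩
    · refine chordBound_of_exists ⟨m + 1, .inr (.inl ⟨by ring, by omega, ?_⟩)⟩
      have : D ≤ 2 * m + 1 := by omega
      have : 1 ≤ m := by omega
      linarith

/-- The condition `hk` serves only `N = 4`: there `k ≤ 1`, and the exceptional value `T = 1` would
give 7 at `N + 3 = 7`, one more than allowed. -/
theorem chordBound_add_three {T D N k : ℤ} (h : ChordBound T N) (hN : 0 ≤ N)
    (hD : D ≤ k * 6) (hlt : k * 3 ≤ N) (hk : k ≤ 1 → T ≤ 0) : ChordBound (T + D) (N + 3) := by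
  obtain ⟨m, ⟨rfl, hT⟩ | ⟨rfl, h', hT⟩ | ⟨rfl, hT⟩ | ⟨rfl, hT⟩⟩ := h.exists
  · exact chordBound_of_exists ⟨m + 1, .inl ⟨by ring, by linarith⟩⟩
  · have : k ≤ m := by omega
    by_cases hm : m = 0
    · subst hm
      exact chordBound_of_exists ⟨1, .inr (.inr (.inl ⟨by norm_num, by linarith⟩))⟩
    · exact chordBound_of_exists ⟨m + 1, .inr (.inl ⟨by ring, by omega, by linarith⟩)⟩
  · exact chordBound_of_exists ⟨2, .inr (.inl ⟨by norm_num, by norm_num, by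
      have := hk (by omega)
      omega⟩)⟩
  · have : k ≤ m := by omega
    exact chordBound_of_exists ⟨m + 1, .inr (.inr (.inr ⟨by ring, by linarith⟩))⟩

/-- For `N ≥ 4` the bound for residue 1 is the smallest of the three; it exceeds none of the others
and forces `T ≤ 0` at `N = 4`. -/
theorem chordBound_of_le {T N : ℤ} (hN : 4 ≤ N) (h : 3 * T ≤ (N - 1) * (N - 4)) :
    ChordBound T N := by
  refine ⟨fun _ => by linarith, fun _ _ => h, ?_, fun _ => by linarith⟩
  rintro rfl
  omega

theorem ChordBound.le {T N : ℤ} (h : ChordBound T N) (hN : 3 ≤ N) : 3 * T ≤ N * (N - 3) := by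
  obtain ⟨m, ⟨rfl, h⟩ | ⟨rfl, h', h⟩ | ⟨rfl, h⟩ | ⟨rfl, h⟩⟩ := h.exists <;> linarith

/-- The weakest bound `N * (N - 3)` suffices as input: since `D ≤ 2 * N`, the slack towards residue
1 is at least `(x - 4) * (2 * N + x - 1)`. -/
theorem chordBound_add_ge_four {T D N x k : ℤ} (h : ChordBound T N) (hx : 4 ≤ x) (hN : x ≤ N)
    (hD : D ≤ k * (2 * x)) (hlt : k * x ≤ N) : ChordBound (T + D) (N + x) := by
  refine chordBound_of_le (by linarith) ?_
  have := h.le (by linarith)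
  have : 0 ≤ (x - 4) * (2 * (N - x) + x - 1) :=
    mul_nonneg (by linarith) (by linarith)
  nlinarith

theorem chord_weight_bound {ι : Type*} [DecidableEq ι] (s : Finset ι) (f : ι → ℕ)
    (w : ι → ι → ℕ) (hf : ∀ i ∈ s, 1 ≤ f i) (hdiag : ∀ i ∈ s, w i i = 0)
    (hw : ∀ i ∈ s, ∀ j ∈ s, w i j + w j i ≤ 2 * f i)
    (hw1 : ∀ i ∈ s, ∀ j ∈ s, f i = 1 → w i j + w j i = 0)
    (hw2 : ∀ i ∈ s, ∀ j ∈ s, f i = 2 → w i j + w j i ≤ 2)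
    (hw22 : ∀ i ∈ s, ∀ j ∈ s, f i = 2 → f j = 2 → w i j + w j i ≤ 1) :
    ChordBound ((∑ i ∈ s, ∑ j ∈ s, w i j : ℕ) : ℤ) ((∑ i ∈ s, f i : ℕ) : ℤ) := by
  induction s using Finset.induction_on_min_value f with
  | empty => simp [ChordBound]
  | insert a s ha hmin ih =>
    specialize ih (fun i hi => hf i (mem_insert_of_mem hi))
      (fun i hi => hdiag i (mem_insert_of_mem hi))
      (fun i hi j hj => hw i (mem_insert_of_mem hi) j (mem_insert_of_mem hj))
      (fun i hi j hj => hw1 i (mem_insert_of_mem hi) j (mem_insert_of_mem hj))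
      (fun i hi j hj => hw2 i (mem_insert_of_mem hi) j (mem_insert_of_mem hj))
      (fun i hi j hj => hw22 i (mem_insert_of_mem hi) j (mem_insert_of_mem hj))
    have has := mem_insert_self a s
    rw [sum_sum_insert ha, hdiag a has, sum_insert ha, add_zero, add_comm (f a)]
    push_cast only [Nat.cast_add]
    have hD : ∑ j ∈ s, (w a j + w j a) ≤ #s * (2 * f a) :=
      sum_le_card_nsmul _ _ _ fun j hj => hw a has j (mem_insert_of_mem hj)
    have hs : #s * f a ≤ ∑ j ∈ s, f j := card_nsmul_le_sum _ _ _ hmin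
    have hfa := hf a has
    obtain hx | hx | hx | hx : f a = 1 ∨ f a = 2 ∨ f a = 3 ∨ 4 ≤ f a := by omega
    · have : ∑ j ∈ s, (w a j + w j a) = 0 :=
        sum_eq_zero fun j hj => hw1 a has j (mem_insert_of_mem hj) hx
      rw [this, hx, Nat.cast_zero, add_zero]
      exact chordBound_add_one ih (by positivity)
    · obtain ⟨t, u, h1, h2⟩ := sum_le_and_le_sum_of_split s (fun j => f j = 2) f
        (fun j => w a j + w j a) (c := 1) (d := 2) (x := 2) (y := 3)
        (fun j hj h => hw22 a has j (mem_insert_of_mem hj) hx h)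
        (fun j hj _ => hw2 a has j (mem_insert_of_mem hj) hx)
        (fun j hj h => h.ge) (fun j hj h => by have := hmin j hj; omega)
      rw [hx]
      exact chordBound_add_two (t := t) (u := u) ih (by positivity) (by positivity)
        (by positivity) (by exact_mod_cast h1) (by exact_mod_cast h2)
    · rw [hx] at hD hs ⊢
      -- At most one earlier block means no pair of distinct blocks, so the earlier total is zero.
      refine chordBound_add_three (k := #s) ih (by positivity) (by exact_mod_cast hD)
        (by exact_mod_cast hs) fun hk => ?_
      have hk : #s ≤ 1 := by exact_mod_cast hk
      refine (Nat.cast_eq_zero.2 (sum_eq_zero fun i hi => sum_eq_zero fun j hj => ?_)).le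
      rw [card_le_one.1 hk j hj i hi, hdiag i (mem_insert_of_mem hi)]
    · obtain rfl | hne := s.eq_empty_or_nonempty
      · simp only [sum_empty, Nat.cast_zero, add_zero, zero_add]
        have : (4 : ℤ) ≤ f a := by exact_mod_cast hx
        exact chordBound_of_le this
          (by rw [mul_zero]; exact mul_nonneg (by linarith) (by linarith))
      · have : f a ≤ ∑ j ∈ s, f j := (Nat.le_mul_of_pos_left _ hne.card_pos).trans hs
        exact chordBound_add_ge_four (k := #s) ih (by exact_mod_cast hx) (by exact_mod_cast this)
          (by exact_mod_cast hD) (by exact_mod_cast hs)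

/-! ### Upper bounds for partitions -/

theorem sum_card_parts_Icc {n : ℕ} (π : Finpartition (Icc 1 n)) : ∑ B ∈ π.parts, #B = n := by
  rw [π.sum_card_parts, Nat.card_Icc, Nat.add_sub_cancel]

theorem six_mul_crLin_le {n : ℕ} (π : Finpartition (Icc 1 n)) :
    6 * (crLin π : ℤ) ≤ (n - 1) * (n - 2) := by
  have h := linear_weight_bound π.parts card
    (fun A B => #(crossingPairs (blockArcs A) (blockArcs B)))
    (fun A hA => (π.nonempty_of_mem_parts hA).card_pos)
    (fun A _ => by rw [crossingPairs_blockArcs_self, card_empty])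
    (fun A hA B _ => card_crossings_blockArcs_le (π.nonempty_of_mem_parts hA) B)
    (fun A hA B hB hAB => card_crossings_blockArcs_le_of_card_eq (π.nonempty_of_mem_parts hA)
      (π.nonempty_of_mem_parts hB) (π.disjoint hA hB hAB))
  rw [sum_card_parts_Icc] at h
  have h' : (crLin π : ℤ) ≤ _ := Int.ofNat_le.2 (numCrossings_biUnion_le π.parts blockArcs)
  linarith

theorem ChordBound.mono {T T' N : ℤ} (h : ChordBound T N) (hT : T' ≤ T) : ChordBound T' N := by
  obtain ⟨h0, h1, h4, h2⟩ := h
  exact ⟨fun h => by linarith [h0 h], fun h h' => by linarith [h1 h h'],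
    fun h => by linarith [h4 h], fun h => by linarith [h2 h]⟩

theorem chordBound_crCirc {n : ℕ} (π : Finpartition (Icc 1 n)) : ChordBound (crCirc π) n := by
  have h := chord_weight_bound π.parts card
    (fun A B => #(crossingPairs (blockChords A) (blockChords B)))
    (fun A hA => (π.nonempty_of_mem_parts hA).card_pos)
    (fun A _ => by rw [crossingPairs_blockChords_self, card_empty])
    (fun A hA B _ => (card_crossings_blockChords_le A B).trans
      (Nat.mul_le_mul_left _ (card_blockChords_le (π.nonempty_of_mem_parts hA))))
    (fun A hA B _ h => Nat.le_zero.1 <| (card_crossings_blockChords_le A B).trans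
      (by rw [blockChords_eq_empty h, card_empty]))
    (fun A hA B _ h => (card_crossings_blockChords_le A B).trans
      (Nat.mul_le_mul_left _ (card_blockChords_le_one h)))
    (fun A hA B _ h h' =>
      card_crossings_le_one (card_blockChords_le_one h) (card_blockChords_le_one h'))
  rw [sum_card_parts_Icc] at h
  exact h.mono (Int.ofNat_le.2 (numCrossings_biUnion_le π.parts blockChords))

/-! ### Partitions into residue classes -/

/-- The partition of `[n]` into the colour classes of `c`. -/
def colourPartition (n : ℕ) (c : ℕ → ℕ) : Finpartition (Icc 1 n) :=
  haveI : DecidableRel (Setoid.ker c).r := fun a b => decEq (c a) (c b)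
  Finpartition.ofSetSetoid (Setoid.ker c) (Icc 1 n)

theorem colourClass_mem_parts {n : ℕ} (c : ℕ → ℕ) {a : ℕ} (ha : a ∈ Icc 1 n) :
    {b ∈ Icc 1 n | c a = c b} ∈ (colourPartition n c).parts := by
  simp only [colourPartition, Finpartition.ofSetSetoid]
  refine mem_image.2 ⟨a, ha, ?_⟩
  ext b
  simp only [mem_filter]
  exact Iff.rfl

theorem arcs_subset_chords {n : ℕ} (π : Finpartition (Icc 1 n)) : arcs π ⊆ chords π :=
  biUnion_mono fun B _ => blockChords_eq B ▸ subset_union_left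

theorem mem_arcs_colourPartition {n : ℕ} {c : ℕ → ℕ} {a b : ℕ} (ha : 1 ≤ a) (hab : a < b)
    (hb : b ≤ n) (hc : c a = c b) (h : ∀ x, x ≤ n → c a = c x → ¬ (a < x ∧ x < b)) :
    (a, b) ∈ arcs (colourPartition n c) := by
  refine mem_biUnion.2 ⟨_, colourClass_mem_parts c (mem_Icc.2 ⟨ha, hab.le.trans hb⟩), ?_⟩
  simp only [mem_blockArcs, mem_filter, mem_Icc]
  exact ⟨by simp; omega, ⟨by omega, hc⟩, hab, fun x hx => h x hx.1.2 hx.2⟩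

theorem mem_chords_colourPartition {n : ℕ} {c : ℕ → ℕ} {a b : ℕ} (ha : 1 ≤ a) (hab : a < b)
    (hb : b ≤ n) (hc : c a = c b) (h : ∀ x, 1 ≤ x → x ≤ n → c a = c x → a ≤ x ∧ x ≤ b) :
    (a, b) ∈ chords (colourPartition n c) := by
  refine mem_biUnion.2 ⟨_, colourClass_mem_parts c (mem_Icc.2 ⟨ha, hab.le.trans hb⟩), ?_⟩
  rw [blockChords_eq, mem_union, mem_closingChords]
  simp only [mem_filter, mem_Icc]
  exact .inr ⟨by simp; omega, ⟨by omega, hc⟩, hab, fun x hx => h x hx.1.1 hx.1.2 hx.2⟩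

/-- The colouring of the numbers up to `3 * k` by their residues modulo `k`, all larger numbers
having an additional colour. -/
def residueColour (k x : ℕ) : ℕ := if x ≤ 3 * k then x % k else k

theorem residueColour_eq {k a x : ℕ} (hk : 0 < k) (ha : a ≤ 3 * k)
    (h : residueColour k a = residueColour k x) : x ≤ 3 * k ∧ a % k = x % k := by
  unfold residueColour at h
  rw [if_pos ha] at h
  split_ifs at h with hx
  · exact ⟨hx, h⟩
  · exact absurd h (Nat.mod_lt a hk).ne

theorem residueColour_add_mul {k a j : ℕ} (h : a + j * k ≤ 3 * k) :
    residueColour k a = residueColour k (a + j * k) := by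
  unfold residueColour
  rw [if_pos h, if_pos (le_self_add.trans h), Nat.add_mul_mod_self_right]

theorem add_le_of_mod_eq {k a x : ℕ} (h : a % k = x % k) (hax : a < x) : a + k ≤ x := by
  have := Nat.le_of_dvd (Nat.sub_pos_of_lt hax)
    (Nat.dvd_of_mod_eq_zero (Nat.sub_mod_eq_zero_of_mod_eq h.symm))
  omega

theorem residue_arc_mem {n k a : ℕ} (hk : 0 < k) (ha : 1 ≤ a) (hn : a + k ≤ n)
    (h3 : a + k ≤ 3 * k) : (a, a + k) ∈ arcs (colourPartition n (residueColour k)) := by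
  refine mem_arcs_colourPartition ha (by omega) hn ?_ fun x _ hx hlt => ?_
  · simpa using residueColour_add_mul (j := 1) (by simpa using h3)
  · have := add_le_of_mod_eq (residueColour_eq hk (by omega) hx).2 hlt.1
    omega

theorem residue_chord_mem {n k a : ℕ} (hk : 0 < k) (ha : 1 ≤ a) (hn : a + 2 * k ≤ n)
    (h3 : a ≤ k) : (a, a + 2 * k) ∈ chords (colourPartition n (residueColour k)) := by
  refine mem_chords_colourPartition ha (by omega) hn (residueColour_add_mul (by omega))
    fun x hx _ h => ?_
  obtain ⟨h1, h2⟩ := residueColour_eq hk (by omega) h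
  constructor
  · by_contra! hlt
    have := add_le_of_mod_eq h2.symm hlt
    omega
  · by_contra! hlt
    have h4 : (a + 2 * k) % k = x % k := by rwa [Nat.add_mul_mod_self_right]
    have := add_le_of_mod_eq h4 hlt
    omega

/-! ### Counting crossings in the residue partitions -/

theorem sum_le_numCrossings_of_translates {E : Finset (ℕ × ℕ)} {k l : ℕ}
    (hE : ∀ i, 1 ≤ i → i ≤ l → (i, i + k) ∈ E) :
    ∑ d ∈ range (k - 1), (l - (d + 1)) ≤ numCrossings E := by
  have hcard : #((range (k - 1)).sigma fun d => Icc 1 (l - (d + 1))) =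
      ∑ d ∈ range (k - 1), (l - (d + 1)) := by simp
  rw [← hcard]
  refine card_le_card_of_injOn
    (fun x => ((x.2, x.2 + k), (x.2 + (x.1 + 1), x.2 + (x.1 + 1) + k))) ?_ ?_
  · rintro ⟨d, i⟩ h
    simp only [coe_sigma, Set.mem_sigma_iff, mem_coe, mem_range, mem_Icc] at h
    have : ((i, i + k), (i + (d + 1), i + (d + 1) + k)) ∈ crossingPairs E E :=
      mem_crossingPairs.2 ⟨hE _ (by omega) (by omega), hE _ (by omega) (by omega),
        by dsimp only; omega, by dsimp only; omega, by dsimp only; omega⟩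
    exact this
  · rintro ⟨d, i⟩ - ⟨d', i'⟩ - h
    simp only [Prod.mk.injEq] at h
    obtain rfl : i = i' := h.1.1
    obtain rfl : d = d' := by omega
    rfl

theorem two_mul_sum_range_sub (l j : ℕ) (h : j ≤ l) :
    2 * ((∑ d ∈ range j, (l - (d + 1)) : ℕ) : ℤ) = j * (2 * l - j - 1) := by
  induction j with
  | zero => simp
  | succ j ih =>
    rw [sum_range_succ, Nat.cast_add, mul_add, ih (by omega), Nat.cast_sub h]
    push_cast
    ring

theorem two_mul_choose_two (n : ℕ) : 2 * ((n.choose 2 : ℕ) : ℤ) = n * (n - 1) := by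
  induction n with
  | zero => simp
  | succ n ih =>
    rw [Nat.choose_succ_succ' n 1, Nat.choose_one_right]
    push_cast
    linarith

theorem exists_crLin_eq (n : ℕ) (hn : 1 ≤ n) :
    ∃ π : Finpartition (Icc 1 n), crLin π = (n - 1).choose 2 / 3 := by
  -- The modulus `j + 1` is `n / 3` rounded up, so all of `[n]` is coloured by residues.
  obtain ⟨j, hj⟩ : ∃ j, n = 3 * j + 3 ∨ n = 3 * j + 2 ∨ n = 3 * j + 1 := ⟨(n - 1) / 3, by omega⟩
  refine ⟨colourPartition n (residueColour (j + 1)), ?_⟩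
  have hup := six_mul_crLin_le (colourPartition n (residueColour (j + 1)))
  have hlow : ∑ d ∈ range (j + 1 - 1), (n - (j + 1) - (d + 1)) ≤
      crLin (colourPartition n (residueColour (j + 1))) :=
    sum_le_numCrossings_of_translates fun i h1 h2 =>
      residue_arc_mem (by omega) h1 (by omega) (by omega)
  rw [Nat.add_sub_cancel] at hlow
  have hs := two_mul_sum_range_sub (n - (j + 1)) j (by omega)
  have hc := two_mul_choose_two (n - 1)
  generalize crLin (colourPartition n (residueColour (j + 1))) = C at *
  generalize ∑ d ∈ range j, (n - (j + 1) - (d + 1)) = S at *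
  generalize (n - 1).choose 2 = B at *
  rw [Nat.cast_sub hn] at hc
  rw [Nat.cast_sub (by omega)] at hs
  have h1 : (3 * C : ℤ) ≤ B := by push_cast at hc; linarith
  have h2 : (B : ℤ) ≤ 3 * S + 1 := by
    -- In fact `B = 3 * S + 1` for `n = 3 * j + 3` and `B = 3 * S` otherwise; the floor absorbs the
    -- 1.
    rcases hj with rfl | rfl | rfl <;> push_cast at hs hc <;> linarith
  omega

/-- One of the six crossings of the triangles `{r, r + k, r + 2 * k}` and
`{s, s + k, s + 2 * k}`. -/
def triangleCrossing (k r s : ℕ) : ℕ → (ℕ × ℕ) × (ℕ × ℕ)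
  | 0 => ((r, r + k), (s, s + k))
  | 1 => ((s, s + k), (r + k, r + k + k))
  | 2 => ((r + k, r + k + k), (s + k, s + k + k))
  | 3 => ((r, r + 2 * k), (s, s + 2 * k))
  | 4 => ((r, r + 2 * k), (s + k, s + k + k))
  | _ => ((r, r + k), (s, s + 2 * k))

theorem triangleCrossing_injective {k r s t r' s' t' : ℕ} (h1 : 1 ≤ r) (h2 : r < s) (h3 : s ≤ k)
    (h1' : 1 ≤ r') (h2' : r' < s') (h3' : s' ≤ k) (ht : t < 6) (ht' : t' < 6)
    (h : triangleCrossing k r s t = triangleCrossing k r' s' t') :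
    r = r' ∧ s = s' ∧ t = t' := by
  interval_cases t <;> interval_cases t' <;>
    simp only [triangleCrossing, Prod.mk.injEq] at h <;> omega

theorem triangleCrossing_mem {E : Finset (ℕ × ℕ)} {k r s t N : ℕ}
    (hE : ∀ i, 1 ≤ i → i + k ≤ N → (i, i + k) ∈ E)
    (hE' : ∀ i, 1 ≤ i → i ≤ k → i + 2 * k ≤ N → (i, i + 2 * k) ∈ E)
    (h1 : 1 ≤ r) (h2 : r < s) (h3 : s ≤ k) (hr : r + 2 * k ≤ N) (hs : s + k ≤ N) (ht : t < 6)
    (hst : 2 ≤ t → s + 2 * k ≤ N) :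
    triangleCrossing k r s t ∈ crossingPairs E E := by
  interval_cases t <;> refine mem_crossingPairs.2 ⟨?_, ?_, ?_⟩ <;>
    first
    | exact hE _ (by omega) (by omega)
    | exact hE' _ (by omega) (by omega) (by omega)
    | (dsimp only; omega)

/-- Class `s = i + 1` is paired with the `i` classes `r < s`, and `c s` crossings are counted per
pair. The condition `M + 2 * k ≤ N + 1` gives every such `r` its third vertex; only the last class
`s = M` may lack one, and then crossings 0 and 1 of `triangleCrossing`, which avoid `s + 2 * k`, are
still available. -/
theorem sum_le_numCrossings_of_triangles {E : Finset (ℕ × ℕ)} {k M N : ℕ} {c : ℕ → ℕ}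
    (hE : ∀ i, 1 ≤ i → i + k ≤ N → (i, i + k) ∈ E)
    (hE' : ∀ i, 1 ≤ i → i ≤ k → i + 2 * k ≤ N → (i, i + 2 * k) ∈ E)
    (hM : M ≤ k) (hMN : M + 2 * k ≤ N + 1) (hc : ∀ s, 1 ≤ s → s ≤ M → c s ≤ 6)
    (hc' : ∀ s, 1 ≤ s → s ≤ M → s + 2 * k ≤ N ∨ c s ≤ 2) :
    ∑ i ∈ range M, i * c (i + 1) ≤ numCrossings E := by
  have hcard : #((range M).sigma fun i => Icc 1 i ×ˢ range (c (i + 1))) =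
      ∑ i ∈ range M, i * c (i + 1) := by simp
  rw [← hcard]
  refine card_le_card_of_injOn (fun x => triangleCrossing k x.2.1 (x.1 + 1) x.2.2) ?_ ?_
  · rintro ⟨i, r, t⟩ h
    simp only [coe_sigma, Set.mem_sigma_iff, mem_coe, mem_range, mem_product, mem_Icc] at h
    have h6 := hc (i + 1) (by omega) (by omega)
    have h7 := hc' (i + 1) (by omega) (by omega)
    exact triangleCrossing_mem (r := r) (s := i + 1) (t := t) hE hE' (by omega) (by omega) (by omega) (by omega) (by omega)
      (by omega) (by omega)
  · rintro ⟨i, r, t⟩ h ⟨i', r', t'⟩ h' heq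
    simp only [coe_sigma, Set.mem_sigma_iff, mem_coe, mem_range, mem_product, mem_Icc] at h h'
    have h6 := hc (i + 1) (by omega) (by omega)
    have h6' := hc (i' + 1) (by omega) (by omega)
    obtain ⟨rfl, hi, rfl⟩ := triangleCrossing_injective (k := k) (r := r) (s := i + 1) (t := t)
      (r' := r') (s' := i' + 1) (t' := t') (by omega) (by omega) (by omega)
      (by omega) (by omega) (by omega) (by omega) (by omega) heq
    obtain rfl : i = i' := by omega
    rfl

theorem sum_le_crCirc_residue {n k M N : ℕ} {c : ℕ → ℕ} (hk : 0 < k) (hn : N ≤ n)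
    (hN : N ≤ 3 * k) (hM : M ≤ k) (hMN : M + 2 * k ≤ N + 1)
    (hc : ∀ s, 1 ≤ s → s ≤ M → c s ≤ 6)
    (hc' : ∀ s, 1 ≤ s → s ≤ M → s + 2 * k ≤ N ∨ c s ≤ 2) :
    ∑ i ∈ range M, i * c (i + 1) ≤ crCirc (colourPartition n (residueColour k)) :=
  sum_le_numCrossings_of_triangles
    (fun i h1 h2 => arcs_subset_chords _ (residue_arc_mem hk h1 (by omega) (by omega)))
    (fun i h1 h2 h3 => residue_chord_mem hk h1 (by omega) h2) hM hMN hc hc'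

theorem sum_range_mul_six (m : ℕ) :
    ((∑ i ∈ range m, i * 6 : ℕ) : ℤ) = 3 * (m * (m - 1)) := by
  rw [← sum_mul, sum_range_id, ← Nat.choose_two_right]
  have := two_mul_choose_two m
  push_cast
  linarith

theorem exists_crCirc_ge (n m r : ℕ) (hm : 1 ≤ m) (hn : n = 3 * m + r) :
    ∃ π : Finpartition (Icc 1 n), 3 * ((m : ℤ) * (m - 1)) ≤ crCirc π := by
  refine ⟨colourPartition n (residueColour m), ?_⟩
  rw [← sum_range_mul_six]
  exact_mod_cast sum_le_crCirc_residue (N := 3 * m) (c := fun _ => 6) hm (by omega) le_rfl le_rfl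
    (by omega) (fun _ _ _ => le_rfl) (fun _ _ _ => .inl (by omega))

/-- With modulus `m + 1` the last class is the pair `{m + 1, 2 * m + 2}`, which crosses each of the
`m` triangles twice. -/
theorem exists_crCirc_ge_of_eq_add_two (n m : ℕ) (hn : n = 3 * m + 2) :
    ∃ π : Finpartition (Icc 1 n), 3 * ((m : ℤ) * (m - 1)) + 2 * m ≤ crCirc π := by
  refine ⟨colourPartition n (residueColour (m + 1)), ?_⟩
  have h := sum_le_crCirc_residue (n := n) (k := m + 1) (M := m + 1) (N := n)
    (c := fun s => if s ≤ m then 6 else 2) (by omega) le_rfl (by omega) le_rfl (by omega)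
    (fun s _ _ => by split_ifs <;> omega)
    (fun s _ _ => by by_cases hs : s ≤ m <;> simp [hs] ; omega)
  have hs : ∑ i ∈ range m, i * (if i + 1 ≤ m then 6 else 2) = ∑ i ∈ range m, i * 6 :=
    sum_congr rfl fun i hi => by rw [if_pos (by have := mem_range.1 hi; omega)]
  rw [sum_range_succ, hs, if_neg (by omega)] at h
  rw [← sum_range_mul_six, mul_comm (2 : ℤ)]
  exact_mod_cast h

/-! ### The bounds meet -/

theorem two_mul_choose_two_pred {n : ℕ} (hn : 1 ≤ n) :
    2 * (((n - 1).choose 2 : ℕ) : ℤ) = (n - 1) * (n - 2) := by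
  rw [two_mul_choose_two, Nat.cast_sub hn]
  push_cast
  ring

theorem isGreatest_crLin {n : ℕ} (hn : 1 ≤ n) :
    IsGreatest (Set.range fun π : Finpartition (Icc 1 n) => crLin π) ((n - 1).choose 2 / 3) := by
  refine ⟨exists_crLin_eq n hn, ?_⟩
  rintro _ ⟨π, rfl⟩
  have := six_mul_crLin_le π
  have := two_mul_choose_two_pred hn
  dsimp only
  omega

theorem isGreatest_crCirc_of_dvd {n : ℕ} (hn : 1 ≤ n) (h3 : 3 ∣ n) :
    IsGreatest (Set.range fun π : Finpartition (Icc 1 n) => crCirc π)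
      (2 * (n - 1).choose 2 / 3) := by
  have hc := two_mul_choose_two_pred hn
  have hup : ∀ π : Finpartition (Icc 1 n), crCirc π ≤ 2 * (n - 1).choose 2 / 3 := by
    intro π
    have h := (chordBound_crCirc π).1 (by omega)
    have : 3 * (crCirc π : ℤ) ≤ 2 * (n - 1).choose 2 := by linarith
    omega
  obtain ⟨m, rfl⟩ := h3
  obtain ⟨π, h⟩ := exists_crCirc_ge (3 * m) m 0 (by omega) rfl
  refine ⟨⟨π, (hup π).antisymm ?_⟩, Set.forall_mem_range.2 hup⟩
  push_cast at hc
  -- Twice the binomial coefficient is `9 * m * (m - 1) + 2`; the remainder 2 disappears in the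
  -- division by 3.
  have : (2 * (3 * m - 1).choose 2 : ℤ) ≤ 3 * crCirc π + 2 := by linarith
  omega

theorem isGreatest_crCirc_of_not_dvd {n : ℕ} (hn : 5 ≤ n) (h3 : ¬ 3 ∣ n) :
    IsGreatest (Set.range fun π : Finpartition (Icc 1 n) => crCirc π)
      (2 * (n - 2).choose 2 / 3) := by
  have hc := two_mul_choose_two_pred (n := n - 1) (by omega)
  rw [Nat.sub_sub, Nat.cast_sub (by omega), Nat.cast_one] at hc
  have hup : ∀ π : Finpartition (Icc 1 n), crCirc π ≤ 2 * (n - 2).choose 2 / 3 := by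
    intro π
    obtain ⟨-, h1, -, h2⟩ := chordBound_crCirc π
    have : 3 * (crCirc π : ℤ) ≤ 2 * (n - 2).choose 2 := by
      obtain hr | hr : (n : ℤ) % 3 = 1 ∨ (n : ℤ) % 3 = 2 := by omega
      · linarith [h1 hr (by omega)]
      · linarith [h2 hr]
    omega
  generalize (n - 2).choose 2 = B at *
  obtain ⟨m, hm⟩ : ∃ m, n = 3 * m + 1 ∨ n = 3 * m + 2 := ⟨n / 3, by omega⟩
  obtain ⟨π, h⟩ : ∃ π : Finpartition (Icc 1 n),
      (2 * B : ℤ) ≤ 3 * crCirc π + 2 := by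
    obtain rfl | rfl := hm
    · obtain ⟨π, h⟩ := exists_crCirc_ge (3 * m + 1) m 1 (by omega) rfl
      push_cast at hc
      exact ⟨π, by linarith⟩
    · obtain ⟨π, h⟩ := exists_crCirc_ge_of_eq_add_two (3 * m + 2) m rfl
      push_cast at hc
      exact ⟨π, by linarith⟩
  exact ⟨⟨π, (hup π).antisymm (by omega)⟩, Set.forall_mem_range.2 hup⟩

theorem floor_one_third_mul (a : ℕ) : ⌊(1 / 3 : ℚ) * (a : ℚ)⌋₊ = a / 3 := by
  rw [← Nat.floor_div_eq_div (K := ℚ)]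
  congr 1
  push_cast
  ring

theorem floor_two_thirds_mul (a : ℕ) : ⌊(2 / 3 : ℚ) * (a : ℚ)⌋₊ = 2 * a / 3 := by
  rw [← Nat.floor_div_eq_div (K := ℚ)]
  congr 1
  push_cast
  ring

end SetPartitionCrossing

theorem theorem8 (n : ℕ) :
    (1 ≤ n →
      IsGreatest (Set.range fun π : Finpartition (Finset.Icc 1 n) => SetPartitionCrossing.crLin π)
        ⌊(1 / 3 : ℚ) * ((n - 1).choose 2 : ℚ)⌋₊) ∧
    (5 ≤ n → 3 ∣ n →
      IsGreatest (Set.range fun π : Finpartition (Finset.Icc 1 n) => SetPartitionCrossing.crCirc π)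
        ⌊(2 / 3 : ℚ) * ((n - 1).choose 2 : ℚ)⌋₊) ∧
    (5 ≤ n → ¬ 3 ∣ n →
      IsGreatest (Set.range fun π : Finpartition (Finset.Icc 1 n) => SetPartitionCrossing.crCirc π)
        ⌊(2 / 3 : ℚ) * ((n - 2).choose 2 : ℚ)⌋₊) := by
  simp only [SetPartitionCrossing.floor_one_third_mul, SetPartitionCrossing.floor_two_thirds_mul]
  exact ⟨fun h => SetPartitionCrossing.isGreatest_crLin h,
    fun h h3 => SetPartitionCrossing.isGreatest_crCirc_of_dvd (by omega) h3,
    fun h h3 => SetPartitionCrossing.isGreatest_crCirc_of_not_dvd h h3⟩
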